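/- Let $\mathcal{A}$ be the unital complex $*$-algebra generated by $a_n$, $n\in\mathbf{N}=\{1,2,3,\ldots\}$, subject to the canonical anticommutation relations $$a_na_m^*+a_m^*a_n=\delta_{nm}I,\qquad a_na_m+a_ma_n=a_n^*a_m^*+a_m^*a_n^*=0\qquad(n,m\in\mathbf{N}).$$ A representation $(\mathcal{H},\pi)$ of $\mathcal{A}$ is a complex Hilbert space $\mathcal{H}$ with a unital $*$-homomorphism $\pi$ from $\mathcal{A}$ to the bounded operators on $\mathcal{H}$; a vector $\Omega\in\mathcal{H}$ is cyclic if $\Omega\neq 0$ and $\pi(\mathcal{A})\Omega$ is dense in $\mathcal{H}$. For integers $p\geq 1$ and $1\leq i\leq p$, let $FF_{p,i}$ denote the class of representations $(\mathcal{H},\pi)$ of $\mathcal{A}$ with a cyclic vector $\Omega$ satisfying $$\pi(a_{p(n-1)+i})\Omega=0\quad\text{and}\quad\pi(a_{p(n-1)+j}^*)\Omega=0\qquad\text{for all } n\geq 1 \text{ and } 1\leq j\leq p,\ j\neq i.$$ Then: 1. For all $p\ge 1$ and $1\le i\le p$, the class $FF_{p,i}$ is non-empty and any two representations belonging to it are unitarily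 equivalent. 2. If $(p,i)\neq(q,j)$, where $1\le i\le p$ and $1\le j\le q$, then no representation in $FF_{p,i}$ is unitarily equivalent to a representation in $FF_{q,j}$. 3. For all $p\ge 1$ and $1\le i\le p$, every representation in $FF_{p,i}$ is irreducible, that is, $\mathcal{H}\ne 0$ and the only closed $\pi(\mathcal{A})$-invariant subspaces of $\mathcal{H}$ are $0$ and $\mathcal{H}$. -/

import Mathlib

open scoped ComplexConjugate

universe u v

noncomputable section

namespace Fermion

/-- Letters of the free complex algebra from which the algebra of fermions is built:
`Sum.inl n` stands for `a n`, and `Sum.inr n` for its adjoint. The modes are indexed by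
`{1, 2, 3, …}`. -/
abbrev Letter : Type := ℕ+ ⊕ ℕ+

/-- The canonical anticommutation relations between the letters. -/
inductive CARRel : FreeAlgebra ℂ Letter → FreeAlgebra ℂ Letter → Prop
  | annihilate_create (n m : ℕ+) :
      CARRel
        (FreeAlgebra.ι ℂ (Sum.inl n) * FreeAlgebra.ι ℂ (Sum.inr m)
          + FreeAlgebra.ι ℂ (Sum.inr m) * FreeAlgebra.ι ℂ (Sum.inl n))
        (if n = m then 1 else 0)
  | annihilate_annihilate (n m : ℕ+) :
      CARRel
        (FreeAlgebra.ι ℂ (Sum.inl n) * FreeAlgebra.ι ℂ (Sum.inl m)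
          + FreeAlgebra.ι ℂ (Sum.inl m) * FreeAlgebra.ι ℂ (Sum.inl n))
        0
  | create_create (n m : ℕ+) :
      CARRel
        (FreeAlgebra.ι ℂ (Sum.inr n) * FreeAlgebra.ι ℂ (Sum.inr m)
          + FreeAlgebra.ι ℂ (Sum.inr m) * FreeAlgebra.ι ℂ (Sum.inr n))
        0

/-- The algebra of fermions: the unital complex algebra generated by `a n` and `(a n)*`,
`n = 1, 2, 3, …`, subject to the canonical anticommutation relations. Its `*`-structure is
the conjugate-linear one defined below. -/
def CARAlgebra : Type := RingQuot CARRel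

instance : Ring CARAlgebra := inferInstanceAs (Ring (RingQuot CARRel))

instance : Algebra ℂ CARAlgebra := inferInstanceAs (Algebra ℂ (RingQuot CARRel))

namespace CARAlgebra

/-- The class of a letter in the algebra of fermions. -/
def gen (x : Letter) : CARAlgebra :=
  RingQuot.mkAlgHom ℂ CARRel (FreeAlgebra.ι ℂ x)

/-- The fermion `a n` (annihilation operator of the mode `n`). -/
def a (n : ℕ+) : CARAlgebra := gen (Sum.inl n)

theorem gen_car (n m : ℕ+) :
    gen (Sum.inl n) * gen (Sum.inr m) + gen (Sum.inr m) * gen (Sum.inl n)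
      = if n = m then 1 else 0 := by
  have h := RingQuot.mkAlgHom_rel ℂ (CARRel.annihilate_create n m)
  rw [map_add, map_mul, map_mul] at h
  refine h.trans ?_
  split_ifs
  · exact map_one _
  · exact map_zero _

theorem gen_inl_inl (n m : ℕ+) :
    gen (Sum.inl n) * gen (Sum.inl m) + gen (Sum.inl m) * gen (Sum.inl n) = 0 := by
  have h := RingQuot.mkAlgHom_rel ℂ (CARRel.annihilate_annihilate n m)
  rw [map_add, map_mul, map_mul, map_zero] at h
  exact h

theorem gen_inr_inr (n m : ℕ+) :
    gen (Sum.inr n) * gen (Sum.inr m) + gen (Sum.inr m) * gen (Sum.inr n) = 0 := by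
  have h := RingQuot.mkAlgHom_rel ℂ (CARRel.create_create n m)
  rw [map_add, map_mul, map_mul, map_zero] at h
  exact h

/-- Two unital algebra homomorphisms that agree on the generators are equal. -/
theorem algHom_ext {B : Type*} [Ring B] [Algebra ℂ B] {f g : CARAlgebra →ₐ[ℂ] B}
    (h : ∀ x, f (gen x) = g (gen x)) : f = g := by
  refine RingQuot.ringQuot_ext' ℂ _ _ (FreeAlgebra.hom_ext ?_)
  funext x
  exact h x

/-- The opposite algebra, with scalars acting through complex conjugation. Algebra
homomorphisms into it are conjugate-linear antihomomorphisms. -/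
def ConjOpp : Type := CARAlgebraᵐᵒᵖ

instance : Ring ConjOpp := inferInstanceAs (Ring CARAlgebraᵐᵒᵖ)

instance : Algebra ℂ ConjOpp :=
  Algebra.compHom CARAlgebraᵐᵒᵖ (starRingEnd ℂ)

/-- The identity map, as a map into the conjugate opposite algebra. -/
def toConj (x : CARAlgebra) : ConjOpp := MulOpposite.op x

/-- The identity map, as a map from the conjugate opposite algebra. -/
def ofConj (x : ConjOpp) : CARAlgebra := MulOpposite.unop x

/-- The adjoint as an algebra homomorphism into the conjugate opposite algebra: it exchanges
the generators `a n` and `(a n)*`. -/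
def starHom : CARAlgebra →ₐ[ℂ] ConjOpp :=
  RingQuot.liftAlgHom ℂ
    ⟨FreeAlgebra.lift ℂ (fun x : Letter => toConj (gen x.swap)), by
      intro x y h
      cases h with
      | annihilate_create n m =>
        simp only [map_add, map_mul, FreeAlgebra.lift_ι_apply, Sum.swap_inl, Sum.swap_inr]
        have h1 := congrArg toConj (gen_car m n)
        rw [add_comm] at h1
        refine ((add_comm _ _).trans h1).trans ?_
        by_cases hnm : n = m
        · subst hnm
          simp only [if_true, map_one]
          rfl
        · rw [if_neg hnm, if_neg (fun h => hnm h.symm), map_zero]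
          rfl
      | annihilate_annihilate n m =>
        simp only [map_add, map_mul, map_zero, FreeAlgebra.lift_ι_apply, Sum.swap_inl]
        exact congrArg toConj (gen_inr_inr m n)
      | create_create n m =>
        simp only [map_add, map_mul, map_zero, FreeAlgebra.lift_ι_apply, Sum.swap_inr]
        exact congrArg toConj (gen_inl_inl m n)⟩

/-- The adjoint operation: `a n ↦ (a n)*`, `(a n)* ↦ a n`, extended as a conjugate-linear
antihomomorphism. -/
instance : Star CARAlgebra := ⟨fun x => ofConj (starHom x)⟩

theorem star_def (x : CARAlgebra) : star x = ofConj (starHom x) := rfl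

theorem star_gen (x : Letter) : star (gen x) = gen x.swap := by
  have h : starHom (gen x) = toConj (gen x.swap) := by
    unfold starHom gen
    exact (RingQuot.liftAlgHom_mkAlgHom_apply ℂ _ _ _).trans (FreeAlgebra.lift_ι_apply _ _)
  rw [star_def, h]
  rfl

theorem star_add' (x y : CARAlgebra) : star (x + y) = star x + star y := by
  rw [star_def, map_add]
  rfl

theorem star_mul' (x y : CARAlgebra) : star (x * y) = star y * star x := by
  rw [star_def, map_mul]
  rfl

theorem star_algebraMap' (c : ℂ) :
    star (algebraMap ℂ CARAlgebra c) = algebraMap ℂ CARAlgebra (conj c) := by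
  rw [star_def, AlgHom.commutes]
  rfl

/-- The square of the adjoint, as an algebra homomorphism. -/
def starStar : CARAlgebra →ₐ[ℂ] CARAlgebra where
  toFun x := star (star x)
  map_one' := by
    have h := star_algebraMap' 1
    rw [map_one, map_one, map_one] at h
    rw [h, h]
  map_zero' := by
    have h := star_algebraMap' 0
    rw [map_zero, map_zero, map_zero] at h
    rw [h, h]
  map_add' x y := by rw [star_add', star_add']
  map_mul' x y := by rw [star_mul', star_mul']
  commutes' c := by rw [star_algebraMap', star_algebraMap', Complex.conj_conj]

theorem starStar_eq : starStar = AlgHom.id ℂ CARAlgebra :=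
  algHom_ext fun x => by
    change star (star (gen x)) = gen x
    rw [star_gen, star_gen, Sum.swap_swap]

instance : StarRing CARAlgebra where
  star_involutive x := DFunLike.congr_fun starStar_eq x
  star_mul := star_mul'
  star_add := star_add'

instance : StarModule ℂ CARAlgebra where
  star_smul c x := by
    rw [Algebra.smul_def, star_mul', star_algebraMap', Algebra.smul_def, Algebra.commutes]
    rfl

theorem star_a (n : ℕ+) : star (a n) = gen (Sum.inr n) := star_gen _

/-- The relation `a n (a m)* + (a m)* a n = δ_{nm}`. -/
theorem a_mul_star_a (n m : ℕ+) :
    a n * star (a m) + star (a m) * a n = if n = m then 1 else 0 := by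
  rw [star_a]
  exact gen_car n m

/-- The relation `a n a m + a m a n = 0`. -/
theorem a_mul_a (n m : ℕ+) : a n * a m + a m * a n = 0 := gen_inl_inl n m

end CARAlgebra

/-- A `*`-representation of the algebra of fermions: a complex Hilbert space with a unital
`*`-homomorphism into its bounded operators. -/
structure Rep where
  /-- The representation space. -/
  H : Type u
  [normedAddCommGroup : NormedAddCommGroup H]
  [innerProductSpace : InnerProductSpace ℂ H]
  [completeSpace : CompleteSpace H]
  /-- The action of the algebra of fermions. -/
  π : CARAlgebra →⋆ₐ[ℂ] (H →L[ℂ] H)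

attribute [instance] Rep.normedAddCommGroup Rep.innerProductSpace Rep.completeSpace

/-- Unitary equivalence of two representations. -/
def Rep.UnitarilyEquivalent (R : Rep.{u}) (S : Rep.{v}) : Prop :=
  ∃ U : R.H ≃ₗᵢ[ℂ] S.H, ∀ (x : CARAlgebra) (ξ : R.H), U (R.π x ξ) = S.π x (U ξ)

/-- A representation is irreducible when its space is nonzero and has no closed invariant
subspace other than `0` and the whole space. -/
def Rep.IsIrreducible (R : Rep.{u}) : Prop :=
  Nontrivial R.H ∧
    ∀ W : Submodule ℂ R.H, IsClosed (W : Set R.H) →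
      (∀ (x : CARAlgebra), ∀ ξ ∈ W, R.π x ξ ∈ W) → W = ⊥ ∨ W = ⊤

/-- A cyclic vector: a nonzero vector whose orbit under the algebra is dense. -/
def Rep.IsCyclicVector (R : Rep.{u}) (Ω : R.H) : Prop :=
  Ω ≠ 0 ∧ Dense {ξ : R.H | ∃ x : CARAlgebra, R.π x Ω = ξ}

/-- The index `p (n - 1) + j`, for `p, n, j ≥ 1`. -/
def modeIndex (p n j : ℕ+) : ℕ+ :=
  ⟨(p : ℕ) * ((n : ℕ) - 1) + j, Nat.add_pos_right _ j.pos⟩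

/-- The class `FF_{p,i}` of representations with a cyclic vector `Ω` that is annihilated by
`a_{p(n-1)+i}` and by `(a_{p(n-1)+j})*` for all `n ≥ 1` and all `j ≠ i` with `1 ≤ j ≤ p`. -/
def FF (p i : ℕ+) : Set Rep.{u} :=
  {R | ∃ Ω : R.H, R.IsCyclicVector Ω ∧
    ∀ n : ℕ+,
      R.π (CARAlgebra.a (modeIndex p n i)) Ω = 0 ∧
      ∀ j : ℕ+, j ≤ p → j ≠ i → R.π (star (CARAlgebra.a (modeIndex p n j))) Ω = 0}

end Fermion

end

noncomputable section

namespace Fermion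

/-! ### Particle–hole exchange and normal ordering in the algebra. -/

namespace CARAlgebra

/-! Let A be the set of modes p(n-1)+i. Membership in `FF p i` asks for a cyclic vacuum in which the
modes outside A are filled (`mem_FF_iff`). Exchanging `a m` with its adjoint for m ∉ A preserves the
anticommutation relations, so normal ordering (`exists_functional_eq`) makes every coefficient ⟪Ω',
π(x)Ω⟫ between A-vacua equal to c(x)⟪Ω', Ω⟫, with c(x) independent of the representation. Hence
cyclic A-vacua give equivalent representations, and next to a cyclic vacuum all vacua are its
multiples. Irreducibility follows because the projection of Ω to a closed invariant subspace is
again a vacuum.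

For inequivalence, each x commutes with all but finitely many number operators. At a mode of the
symmetric difference of A and B, an A-vacuum and a B-vacuum have different occupation numbers, so an
infinite symmetric difference forces every coefficient between them to vanish
(`IsVacuum.eq_zero_of_infinite`). Different pairs (p, i) give progressions that differ infinitely
often.

Existence comes from Jordan–Wigner operators on ℓ² of the finite sets of modes, with the letters
exchanged off A. These sets are lifted so that the model exists in every universe. -/

open Classical in
/-- The annihilator of the mode `m` in the picture where exactly the modes outside `A` are
filled: `a m` for `m ∈ A` and `(a m)*` for `m ∉ A`. -/
def annih (A : Set ℕ+) (m : ℕ+) : CARAlgebra := if m ∈ A then a m else star (a m)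

theorem star_a_mul_star_a (n m : ℕ+) :
    star (a n) * star (a m) + star (a m) * star (a n) = 0 := by
  rw [star_a, star_a]
  exact gen_inr_inr n m

/-- In the mixed cases the modes are distinct, and the relation becomes one between two annihilators
or two adjoints. -/
theorem annih_mul_star_annih (A : Set ℕ+) (n m : ℕ+) :
    annih A n * star (annih A m) + star (annih A m) * annih A n = if n = m then 1 else 0 := by
  by_cases hn : n ∈ A <;> by_cases hm : m ∈ A
  · simp only [annih, hn, hm, if_true]
    exact a_mul_star_a n m
  · have h : n ≠ m := fun h => hm (h ▸ hn)
    simp only [annih, hn, hm, if_true, if_false, h, star_star]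
    exact a_mul_a n m
  · have h : n ≠ m := fun h => hn (h ▸ hm)
    simp only [annih, hn, hm, if_true, if_false, h]
    exact star_a_mul_star_a n m
  · simp only [annih, hn, hm, if_false, star_star]
    rw [add_comm, a_mul_star_a]
    simp only [eq_comm]

theorem adjoin_range_gen : Algebra.adjoin ℂ (Set.range gen) = ⊤ := by
  set S := Algebra.adjoin ℂ (Set.range gen) with hS
  have hg (x : Letter) : gen x ∈ S := Algebra.subset_adjoin ⟨x, rfl⟩
  rw [eq_top_iff]
  intro x _
  obtain ⟨y, rfl⟩ := RingQuot.mkAlgHom_surjective ℂ CARRel x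
  induction y using FreeAlgebra.induction with
  | grade0 r => rw [AlgHom.commutes]; exact S.algebraMap_mem r
  | grade1 x => exact hg x
  | mul x y hx hy => rw [map_mul]; exact S.mul_mem (hx trivial) (hy trivial)
  | add x y hx hy => rw [map_add]; exact S.add_mem (hx trivial) (hy trivial)

/-- A property closed under the algebra operations and satisfied by all `a n` and `(a n)*`
holds everywhere. -/
theorem induction {P : CARAlgebra → Prop} (ha : ∀ n, P (a n)) (hs : ∀ n, P (star (a n)))
    (hc : ∀ c, P (algebraMap ℂ CARAlgebra c)) (hadd : ∀ x y, P x → P y → P (x + y))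
    (hmul : ∀ x y, P x → P y → P (x * y)) (x : CARAlgebra) : P x := by
  have hx : x ∈ Algebra.adjoin ℂ (Set.range gen) := adjoin_range_gen ▸ Algebra.mem_top
  induction hx using Algebra.adjoin_induction with
  | mem x hx =>
    obtain ⟨n | n, rfl⟩ := hx
    · exact ha n
    · rw [← star_a]; exact hs n
  | algebraMap r => exact hc r
  | add x y _ _ hx hy => exact hadd x y hx hy
  | mul x y _ _ hx hy => exact hmul x y hx hy

theorem induction_annih (A : Set ℕ+) {P : CARAlgebra → Prop} (ha : ∀ n, P (annih A n))
    (hs : ∀ n, P (star (annih A n))) (hc : ∀ c, P (algebraMap ℂ CARAlgebra c))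
    (hadd : ∀ x y, P x → P y → P (x + y)) (hmul : ∀ x y, P x → P y → P (x * y))
    (x : CARAlgebra) : P x := by
  refine induction (fun n => ?_) (fun n => ?_) hc hadd hmul x <;> by_cases hn : n ∈ A
  · simpa only [annih, hn, if_true] using ha n
  · simpa only [annih, hn, if_false, star_star] using hs n
  · simpa only [annih, hn, if_true] using hs n
  · simpa only [annih, hn, if_false] using ha n

/-- The subalgebra generated by the creators. -/
def creators (A : Set ℕ+) : Subalgebra ℂ CARAlgebra :=
  Algebra.adjoin ℂ (Set.range fun m => star (annih A m))

/-- Each creator passed changes the sign and may leave a scalar, so y is x with signs altered and z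
collects the contractions. -/
theorem annih_mul_mem_creators (A : Set ℕ+) (m : ℕ+) {x : CARAlgebra} (hx : x ∈ creators A) :
    ∃ y ∈ creators A, ∃ z ∈ creators A, annih A m * x = y * annih A m + z := by
  induction hx using Algebra.adjoin_induction with
  | mem x hx =>
    obtain ⟨k, rfl⟩ := hx
    refine ⟨-star (annih A k), neg_mem (Algebra.subset_adjoin ⟨k, rfl⟩),
      if m = k then 1 else 0, ?_, ?_⟩
    · split_ifs
      · exact one_mem _
      · exact zero_mem _
    · rw [← annih_mul_star_annih A m k, neg_mul]
      abel
  | algebraMap r =>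
    exact ⟨_, Subalgebra.algebraMap_mem _ r, 0, zero_mem _, by
      rw [add_zero, Algebra.commutes]⟩
  | add x x' _ _ hx hx' =>
    obtain ⟨y, hy, z, hz, h⟩ := hx
    obtain ⟨y', hy', z', hz', h'⟩ := hx'
    exact ⟨y + y', add_mem hy hy', z + z', add_mem hz hz', by rw [mul_add, h, h']; noncomm_ring⟩
  | mul x x' _ hx'm hx hx' =>
    obtain ⟨y, hy, z, hz, h⟩ := hx
    obtain ⟨y', hy', z', hz', h'⟩ := hx'
    refine ⟨y * y', mul_mem hy hy', y * z' + z * x',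
      add_mem (mul_mem hy hz') (mul_mem hz hx'm), ?_⟩
    rw [← mul_assoc, h, add_mul, mul_assoc, h']
    noncomm_ring

/-- Normal ordering: modulo the left ideal generated by the annihilators, every element lies in
the algebra generated by the creators. -/
theorem exists_creators_sub_mem (A : Set ℕ+) (x : CARAlgebra) :
    ∃ y ∈ creators A, x - y ∈ Ideal.span (Set.range (annih A)) := by
  -- The extra right factor makes the claim pass to products x * x': first x' is reduced against n,
  -- then x against the result.
  suffices h : ∀ n ∈ creators A, ∃ y ∈ creators A,
      x * n - y ∈ Ideal.span (Set.range (annih A)) by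
    simpa only [mul_one] using h 1 (one_mem _)
  induction x using induction_annih A with
  | ha m =>
    intro n hn
    obtain ⟨y, hy, z, hz, h⟩ := annih_mul_mem_creators A m hn
    refine ⟨z, hz, ?_⟩
    rw [h, add_sub_cancel_right]
    exact Ideal.mul_mem_left _ _ (Ideal.subset_span ⟨m, rfl⟩)
  | hs m =>
    intro n hn
    exact ⟨_, mul_mem (Algebra.subset_adjoin ⟨m, rfl⟩) hn, by
      rw [sub_self]; exact Submodule.zero_mem _⟩
  | hc c =>
    intro n hn
    exact ⟨_, mul_mem (Subalgebra.algebraMap_mem _ c) hn, by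
      rw [sub_self]; exact Submodule.zero_mem _⟩
  | hadd x x' hx hx' =>
    intro n hn
    obtain ⟨y, hy, h⟩ := hx n hn
    obtain ⟨y', hy', h'⟩ := hx' n hn
    refine ⟨y + y', add_mem hy hy', ?_⟩
    convert Submodule.add_mem _ h h' using 1
    noncomm_ring
  | hmul x x' hx hx' =>
    intro n hn
    obtain ⟨y', hy', h'⟩ := hx' n hn
    obtain ⟨y, hy, h⟩ := hx y' hy'
    refine ⟨y, hy, ?_⟩
    convert Submodule.add_mem _ (Ideal.mul_mem_left _ x h') h using 1
    noncomm_ring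

/-- The scalar is the constant term of x as a polynomial in the creators; it is fixed before the
functional is chosen. -/
theorem exists_functional_creators_mul (A : Set ℕ+) {x : CARAlgebra} (hx : x ∈ creators A) :
    ∃ c : ℂ, ∀ φ : CARAlgebra →ₗ[ℂ] ℂ, (∀ m y, φ (star (annih A m) * y) = 0) →
      ∀ y, φ (x * y) = c * φ y := by
  induction hx using Algebra.adjoin_induction with
  | mem x hx =>
    obtain ⟨k, rfl⟩ := hx
    exact ⟨0, fun φ hφ y => by rw [zero_mul]; exact hφ k y⟩
  | algebraMap r =>
    exact ⟨r, fun φ _ y => by rw [← Algebra.smul_def, map_smul, smul_eq_mul]⟩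
  | add x x' _ _ hx hx' =>
    obtain ⟨c, h⟩ := hx
    obtain ⟨c', h'⟩ := hx'
    exact ⟨c + c', fun φ hφ y => by rw [add_mul, map_add, h φ hφ, h' φ hφ, add_mul]⟩
  | mul x x' _ _ hx hx' =>
    obtain ⟨c, h⟩ := hx
    obtain ⟨c', h'⟩ := hx'
    exact ⟨c * c', fun φ hφ y => by rw [mul_assoc, h φ hφ, h' φ hφ, mul_assoc]⟩

/-- A functional that kills the annihilators on the right and the creators on the left is
determined by its value at `1`. -/
theorem exists_functional_eq (A : Set ℕ+) (x : CARAlgebra) :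
    ∃ c : ℂ, ∀ φ : CARAlgebra →ₗ[ℂ] ℂ, (∀ m y, φ (y * annih A m) = 0) →
      (∀ m y, φ (star (annih A m) * y) = 0) → φ x = c * φ 1 := by
  obtain ⟨y, hy, hxy⟩ := exists_creators_sub_mem A x
  obtain ⟨c, hc⟩ := exists_functional_creators_mul A hy
  refine ⟨c, fun φ h₁ h₂ => ?_⟩
  have h₃ : φ (x - y) = 0 := by
    generalize x - y = w at hxy
    induction hxy using Submodule.span_induction with
    | mem z hz =>
      obtain ⟨m, rfl⟩ := hz
      simpa only [one_mul] using h₁ m 1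
    | zero => exact map_zero _
    | add z w _ _ hz hw => rw [map_add, hz, hw, add_zero]
    | smul r z hz' hz =>
      -- `φ` is not linear over left multiplication, so `φ z = 0` does not help; a second induction,
      -- over all left factors `r`, is needed.
      clear hz
      rw [smul_eq_mul]
      induction hz' using Submodule.span_induction generalizing r with
      | mem z hz =>
        obtain ⟨m, rfl⟩ := hz
        exact h₁ m r
      | zero => rw [mul_zero, map_zero]
      | add z w _ _ hz hw => rw [mul_add, map_add, hz, hw, add_zero]
      | smul s z _ hz => rw [smul_eq_mul, ← mul_assoc]; exact hz _
  rw [map_sub, sub_eq_zero] at h₃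
  rw [h₃, ← hc φ h₂ 1, mul_one]

/-- Every element commutes with all but finitely many number operators `(a m)* a m`. -/
theorem finite_not_commute_number (x : CARAlgebra) :
    {m | ¬ Commute (star (a m) * a m) x}.Finite := by
  induction x using induction with
  | ha n =>
    refine (Set.finite_singleton n).subset fun m hm => ?_
    by_contra hmn
    apply hm
    have h₁ := a_mul_a m n
    have h₂ := a_mul_star_a n m
    rw [if_neg (fun h => hmn h.symm)] at h₂
    rw [add_eq_zero_iff_eq_neg] at h₁ h₂
    change star (a m) * a m * a n = a n * (star (a m) * a m)
    rw [mul_assoc, h₁, ← mul_assoc, h₂, mul_neg, neg_mul, mul_assoc]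
  | hs n =>
    refine (Set.finite_singleton n).subset fun m hm => ?_
    by_contra hmn
    apply hm
    have h₁ := star_a_mul_star_a n m
    have h₂ := a_mul_star_a m n
    rw [if_neg (show ¬ m = n from hmn)] at h₂
    rw [add_eq_zero_iff_eq_neg] at h₁ h₂
    change star (a m) * a m * star (a n) = star (a n) * (star (a m) * a m)
    rw [mul_assoc, h₂, ← mul_assoc, h₁, mul_neg, neg_mul, mul_assoc]
  | hc c =>
    convert Set.finite_empty
    refine Set.eq_empty_of_forall_notMem fun m hm => hm (Algebra.commutes c _).symm
  | hadd x y hx hy =>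
    refine (hx.union hy).subset fun m hm => ?_
    by_contra h
    simp only [Set.mem_union, Set.mem_ofPred_eq, not_or, not_not] at h
    exact hm (h.1.add_right h.2)
  | hmul x y hx hy =>
    refine (hx.union hy).subset fun m hm => ?_
    by_contra h
    simp only [Set.mem_union, Set.mem_ofPred_eq, not_or, not_not] at h
    exact hm (h.1.mul_right h.2)

end CARAlgebra

open CARAlgebra
open scoped InnerProductSpace ENNReal ComplexConjugate

/-! ### Vacuum vectors: uniqueness, irreducibility, disjointness. -/

namespace Rep

/-- `Ω` is killed by `a m` for all `m ∈ A` and by `(a m)*` for all `m ∉ A`. -/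
def IsVacuum (R : Rep.{u}) (A : Set ℕ+) (Ω : R.H) : Prop :=
  ∀ m, R.π (annih A m) Ω = 0

theorem isVacuum_iff {R : Rep.{u}} {A : Set ℕ+} {Ω : R.H} :
    R.IsVacuum A Ω ↔
      (∀ m ∈ A, R.π (a m) Ω = 0) ∧ ∀ m ∉ A, R.π (star (a m)) Ω = 0 := by
  refine ⟨fun h => ⟨fun m hm => ?_, fun m hm => ?_⟩, fun h m => ?_⟩
  · simpa only [annih, hm, if_true] using h m
  · simpa only [annih, hm, if_false] using h m
  · by_cases hm : m ∈ A
    · simpa only [annih, hm, if_true] using h.1 m hm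
    · simpa only [annih, hm, if_false] using h.2 m hm

variable {R : Rep.{u}} {S : Rep.{v}} {A B : Set ℕ+}

theorem map_mul_apply (R : Rep.{u}) (x y : CARAlgebra) (ξ : R.H) :
    R.π (x * y) ξ = R.π x (R.π y ξ) := by
  rw [map_mul]; rfl

theorem inner_map_left (R : Rep.{u}) (x : CARAlgebra) (ξ η : R.H) :
    ⟪R.π x ξ, η⟫_ℂ = ⟪ξ, R.π (star x) η⟫_ℂ := by
  rw [map_star, ContinuousLinearMap.star_eq_adjoint, ContinuousLinearMap.adjoint_inner_right]

/-- The map `x ↦ π x Ω`. -/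
def orbit (R : Rep.{u}) (Ω : R.H) : CARAlgebra →ₗ[ℂ] R.H where
  toFun x := R.π x Ω
  map_add' x y := by rw [map_add]; rfl
  map_smul' c x := by rw [map_smul]; rfl

@[simp]
theorem orbit_apply (Ω : R.H) (x : CARAlgebra) : R.orbit Ω x = R.π x Ω := rfl

theorem IsCyclicVector.denseRange_orbit {Ω : R.H} (h : R.IsCyclicVector Ω) :
    DenseRange (R.orbit Ω) := h.2

theorem IsCyclicVector.eq_zero_of_inner {Ω ξ : R.H} (h : R.IsCyclicVector Ω)
    (hξ : ∀ x, ⟪ξ, R.π x Ω⟫_ℂ = 0) : ξ = 0 := by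
  refine h.2.eq_zero_of_inner_right ℂ ?_
  rintro _ ⟨x, rfl⟩
  exact inner_eq_zero_symm.1 (hξ x)

/-- All matrix coefficients between vacuum vectors are given by one functional. -/
theorem exists_inner_vacuum (A : Set ℕ+) (x : CARAlgebra) :
    ∃ c : ℂ, (∀ (R : Rep.{u}) (Ω Ω' : R.H), R.IsVacuum A Ω → R.IsVacuum A Ω' →
        ⟪Ω', R.π x Ω⟫_ℂ = c * ⟪Ω', Ω⟫_ℂ) ∧
      ∀ (R : Rep.{v}) (Ω Ω' : R.H), R.IsVacuum A Ω → R.IsVacuum A Ω' →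
        ⟪Ω', R.π x Ω⟫_ℂ = c * ⟪Ω', Ω⟫_ℂ := by
  -- The constant depends on `A` and `x` alone, so it serves representations in two universes at
  -- once.
  obtain ⟨c, hc⟩ := exists_functional_eq A x
  refine ⟨c, fun R Ω Ω' h h' => ?_, fun R Ω Ω' h h' => ?_⟩ <;>
  · have := hc ((innerSL ℂ Ω').toLinearMap ∘ₗ R.orbit Ω)
      (fun m y => by
        change ⟪Ω', R.π (y * annih A m) Ω⟫_ℂ = 0
        rw [map_mul_apply, h m, map_zero, inner_zero_right])
      (fun m y => by
        change ⟪Ω', R.π (star (annih A m) * y) Ω⟫_ℂ = 0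
        rw [map_mul_apply, ← inner_map_left, h' m, inner_zero_left])
    change ⟪Ω', R.π x Ω⟫_ℂ = c * ⟪Ω', R.π 1 Ω⟫_ℂ at this
    rwa [map_one] at this

theorem IsVacuum.smul {Ω : R.H} (h : R.IsVacuum A Ω) (c : ℂ) : R.IsVacuum A (c • Ω) :=
  fun m => by rw [map_smul, h m, smul_zero]

theorem IsVacuum.sub {Ω Ω' : R.H} (h : R.IsVacuum A Ω) (h' : R.IsVacuum A Ω') :
    R.IsVacuum A (Ω - Ω') :=
  fun m => by rw [map_sub, h m, h' m, sub_zero]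

theorem IsCyclicVector.smul {Ω : R.H} (h : R.IsCyclicVector Ω) {c : ℂ} (hc : c ≠ 0) :
    R.IsCyclicVector (c • Ω) := by
  refine ⟨smul_ne_zero hc h.1, ?_⟩
  convert h.2 using 2
  ext ξ
  constructor
  · rintro ⟨x, rfl⟩
    exact ⟨c • x, by rw [map_smul, map_smul]; rfl⟩
  · rintro ⟨x, rfl⟩
    refine ⟨c⁻¹ • x, ?_⟩
    rw [map_smul, map_smul, smul_apply, smul_smul, mul_inv_cancel₀ hc,
      one_smul]

/-- A vacuum vector is unique up to a scalar if it is cyclic. -/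
theorem IsVacuum.eq_smul {Ω Ω' : R.H} (hΩ : R.IsCyclicVector Ω) (h : R.IsVacuum A Ω)
    (h' : R.IsVacuum A Ω') : ∃ c : ℂ, Ω' = c • Ω := by
  set c := ⟪Ω, Ω'⟫_ℂ / ⟪Ω, Ω⟫_ℂ with hc
  have hne : ⟪Ω, Ω⟫_ℂ ≠ 0 := inner_self_ne_zero.2 hΩ.1
  -- The difference is a vacuum orthogonal to `Ω`, hence orthogonal to the whole orbit of `Ω`.
  refine ⟨c, sub_eq_zero.1 (hΩ.eq_zero_of_inner fun x => ?_)⟩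
  obtain ⟨d, hd, -⟩ := exists_inner_vacuum.{u, u} A x
  rw [hd R Ω _ h (h'.sub (h.smul c))]
  have : ⟪Ω, Ω' - c • Ω⟫_ℂ = 0 := by
    rw [inner_sub_right, inner_smul_right, hc, div_mul_cancel₀ _ hne, sub_self]
  rw [← inner_conj_symm, this, map_zero, mul_zero]

/-- The squared norm is the vacuum coefficient of `star x * x`, a universal multiple of the squared
norm of the vacuum. -/
theorem IsVacuum.inner_map_map {Ω : R.H} {Ω' : S.H} (h : R.IsVacuum A Ω) (h' : S.IsVacuum A Ω')
    (hn : ‖Ω‖ = ‖Ω'‖) (x : CARAlgebra) : ‖S.π x Ω'‖ = ‖R.π x Ω‖ := by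
  obtain ⟨d, hd, hd'⟩ := exists_inner_vacuum.{u, v} A (star x * x)
  have h₁ := hd R Ω Ω h h
  have h₂ := hd' S Ω' Ω' h' h'
  have h₃ : ⟪S.π x Ω', S.π x Ω'⟫_ℂ = ⟪R.π x Ω, R.π x Ω⟫_ℂ := by
    rw [inner_map_left, inner_map_left, ← map_mul_apply, ← map_mul_apply, h₁, h₂,
      inner_self_eq_norm_sq_to_K, inner_self_eq_norm_sq_to_K, hn]
  rw [inner_self_eq_norm_sq_to_K, inner_self_eq_norm_sq_to_K] at h₃
  norm_cast at h₃
  exact (sq_eq_sq₀ (norm_nonneg _) (norm_nonneg _)).1 h₃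

/-- As in GNS uniqueness, the isometry between the dense orbits extends to a unitary, which
intertwines by continuity. -/
theorem unitarilyEquivalent_of_norm_eq {Ω : R.H} {Ω' : S.H} (hΩ : R.IsCyclicVector Ω)
    (hΩ' : S.IsCyclicVector Ω') (hn : ∀ x, ‖S.π x Ω'‖ = ‖R.π x Ω‖) :
    R.UnitarilyEquivalent S := by
  let U := (LinearEquiv.refl ℂ CARAlgebra).extendOfIsometry (R.orbit Ω) (S.orbit Ω')
    hΩ.denseRange_orbit hΩ'.denseRange_orbit hn
  have hU (x : CARAlgebra) : U (R.π x Ω) = S.π x Ω' :=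
    LinearEquiv.extendOfIsometry_eq _ _ _ hΩ.denseRange_orbit hΩ'.denseRange_orbit hn x
  refine ⟨U, fun x ξ => ?_⟩
  refine hΩ.denseRange_orbit.induction_on (p := fun ξ => U (R.π x ξ) = S.π x (U ξ)) ξ ?_ ?_
  · exact isClosed_eq (U.continuous.comp (R.π x).continuous) ((S.π x).continuous.comp U.continuous)
  · intro y
    rw [orbit_apply, ← map_mul_apply, hU, hU, map_mul_apply]

theorem unitarilyEquivalent_of_isVacuum {Ω : R.H} {Ω' : S.H} (hΩ : R.IsCyclicVector Ω)
    (hΩ' : S.IsCyclicVector Ω') (h : R.IsVacuum A Ω) (h' : S.IsVacuum A Ω') :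
    R.UnitarilyEquivalent S := by
  have hc : ((‖Ω‖ / ‖Ω'‖ : ℝ) : ℂ) ≠ 0 := by
    exact_mod_cast div_ne_zero (norm_ne_zero_iff.2 hΩ.1) (norm_ne_zero_iff.2 hΩ'.1)
  refine unitarilyEquivalent_of_norm_eq hΩ (hΩ'.smul hc) (h.inner_map_map (h'.smul _) ?_)
  rw [norm_smul, Complex.norm_real, Real.norm_eq_abs, abs_of_nonneg (by positivity),
    div_mul_cancel₀ _ (norm_ne_zero_iff.2 hΩ'.1)]

theorem IsCyclicVector.eq_top {Ω : R.H} (hΩ : R.IsCyclicVector Ω) {W : Submodule ℂ R.H}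
    (hW : IsClosed (W : Set R.H)) (hinv : ∀ (x : CARAlgebra), ∀ ξ ∈ W, R.π x ξ ∈ W)
    (h : Ω ∈ W) : W = ⊤ := by
  rw [eq_top_iff]
  intro ξ _
  refine hΩ.denseRange_orbit.induction_on (p := fun ξ => ξ ∈ W) ξ hW fun x => hinv x Ω h

theorem isIrreducible_of_isVacuum {Ω : R.H} (hΩ : R.IsCyclicVector Ω) (h : R.IsVacuum A Ω) :
    R.IsIrreducible := by
  refine ⟨⟨⟨Ω, 0, hΩ.1⟩⟩, fun W hW hinv => ?_⟩
  have : CompleteSpace W := hW.completeSpace_coe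
  have hinv' (x : CARAlgebra) (ξ : R.H) (hξ : ξ ∈ Wᗮ) : R.π x ξ ∈ Wᗮ := by
    rw [Submodule.mem_orthogonal]
    intro η hη
    rw [← star_star x, ← inner_map_left]
    exact hξ _ (hinv _ _ hη)
  obtain ⟨w, hw, w', hw', hsum⟩ := W.exists_add_mem_mem_orthogonal Ω
  have hwv : R.IsVacuum A w := by
    intro m
    have h₀ := h m
    rw [hsum, map_add, add_eq_zero_iff_eq_neg] at h₀
    have h₁ : R.π (annih A m) w ∈ Wᗮ := h₀ ▸ neg_mem (hinv' _ _ hw')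
    -- The vector lies both in `W` and in its orthogonal complement.
    exact inner_self_eq_zero.1 (h₁ _ (hinv _ _ hw))
  obtain ⟨c, rfl⟩ := IsVacuum.eq_smul hΩ h hwv
  by_cases hc : c = 0
  · left
    rw [hc, zero_smul, zero_add] at hsum
    have := hΩ.eq_top W.isClosed_orthogonal hinv' (hsum ▸ hw')
    rwa [Submodule.orthogonal_eq_top_iff] at this
  · right
    refine hΩ.eq_top hW hinv ?_
    simpa only [smul_smul, inv_mul_cancel₀ hc, one_smul] using W.smul_mem c⁻¹ hw

theorem IsVacuum.number_of_mem {Ω : R.H} (h : R.IsVacuum A Ω) {m : ℕ+} (hm : m ∈ A) :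
    R.π (star (a m) * a m) Ω = 0 := by
  rw [map_mul_apply, (isVacuum_iff.1 h).1 m hm, map_zero]

theorem IsVacuum.number_of_notMem {Ω : R.H} (h : R.IsVacuum A Ω) {m : ℕ+} (hm : m ∉ A) :
    R.π (star (a m) * a m) Ω = Ω := by
  have h₁ : R.π (a m * star (a m) + star (a m) * a m) Ω = Ω := by
    rw [a_mul_star_a, if_pos rfl, map_one]; rfl
  rwa [map_add, add_apply, map_mul_apply, (isVacuum_iff.1 h).2 m hm, map_zero,
    zero_add] at h₁

theorem isSelfAdjoint_number (m : ℕ+) : star (star (a m) * a m) = star (a m) * a m := by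
  rw [star_mul, star_star]

/-- Vacuum vectors whose occupied modes differ infinitely often are disjoint. -/
theorem IsVacuum.eq_zero_of_infinite {Ω Ω' : R.H} (hΩ : R.IsCyclicVector Ω)
    (h : R.IsVacuum A Ω) (h' : R.IsVacuum B Ω') (hAB : (symmDiff A B).Infinite) : Ω' = 0 := by
  refine hΩ.eq_zero_of_inner fun x => ?_
  -- The self-adjoint number operator of this mode commutes with `x` and has eigenvalues 0 and 1, in
  -- some order, on the two vacua.
  obtain ⟨m, hm, hmx⟩ := (hAB.sdiff (finite_not_commute_number x)).nonempty
  have hcomm : (star (a m) * a m) * x = x * (star (a m) * a m) := not_not.1 hmx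
  have key : ⟪R.π (star (a m) * a m) Ω', R.π x Ω⟫_ℂ
      = ⟪Ω', R.π x (R.π (star (a m) * a m) Ω)⟫_ℂ := by
    rw [inner_map_left, isSelfAdjoint_number, ← map_mul_apply, hcomm, map_mul_apply]
  rcases hm with ⟨hA, hB⟩ | ⟨hB, hA⟩
  · rwa [h.number_of_mem hA, h'.number_of_notMem hB, map_zero, inner_zero_right] at key
  · rw [h.number_of_notMem hA, h'.number_of_mem hB, inner_zero_left] at key
    exact key.symm

theorem not_unitarilyEquivalent_of_infinite {Ω : R.H} {Ω' : S.H} (hΩ : R.IsCyclicVector Ω)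
    (hΩ' : S.IsCyclicVector Ω') (h : R.IsVacuum A Ω) (h' : S.IsVacuum B Ω')
    (hAB : (symmDiff A B).Infinite) : ¬ R.UnitarilyEquivalent S := by
  rintro ⟨U, hU⟩
  have h₁ : S.IsVacuum A (U Ω) := fun m => by rw [← hU, h m, map_zero]
  have h₂ : U Ω = 0 := IsVacuum.eq_zero_of_infinite hΩ' h' h₁ (symmDiff_comm A B ▸ hAB)
  exact hΩ.1 (by simpa using h₂)

end Rep

/-! ### Arithmetic progressions of modes. -/

/-- The modes congruent to `i` modulo `p`. -/
def progression (p i : ℕ+) : Set ℕ+ := {m | ∃ n, m = modeIndex p n i}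

theorem modeIndex_coe (p n j : ℕ+) : (modeIndex p n j : ℕ) = p * (n - 1) + j := rfl

/-- The bound `i ≤ m` cannot be dropped, since `i ≤ p` is not assumed here. -/
theorem mem_progression {p i m : ℕ+} :
    m ∈ progression p i ↔ i ≤ m ∧ (m : ℕ) ≡ i [MOD p] := by
  constructor
  · rintro ⟨n, rfl⟩
    refine ⟨?_, ?_⟩
    · rw [← PNat.coe_le_coe, modeIndex_coe]; exact Nat.le_add_left _ _
    · rw [modeIndex_coe, Nat.ModEq, Nat.mul_add_mod]
  · rintro ⟨h, h'⟩
    obtain ⟨k, hk⟩ := (Nat.modEq_iff_dvd' (PNat.coe_le_coe _ _ |>.2 h)).1 h'.symm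
    refine ⟨k.succPNat, PNat.coe_injective ?_⟩
    rw [modeIndex_coe, Nat.succPNat_coe, Nat.succ_sub_one, ← hk]
    exact (Nat.sub_add_cancel (PNat.coe_le_coe _ _ |>.2 h)).symm

theorem exists_modeIndex (p m : ℕ+) : ∃ n j, j ≤ p ∧ m = modeIndex p n j := by
  have hp := p.pos
  have hm := m.pos
  -- Dividing `m - 1` rather than `m` puts the shifted remainder in 1, …, p.
  refine ⟨((m - 1 : ℕ) / p).succPNat, ((m - 1 : ℕ) % p).succPNat, ?_, ?_⟩
  · rw [← PNat.coe_le_coe, Nat.succPNat_coe]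
    exact Nat.mod_lt _ hp
  · apply PNat.coe_injective
    rw [modeIndex_coe, Nat.succPNat_coe, Nat.succPNat_coe, Nat.succ_sub_one]
    have := Nat.div_add_mod (m - 1 : ℕ) p
    omega

theorem progression_disjoint {p i j : ℕ+} (hi : i ≤ p) (hj : j ≤ p) (hij : i ≠ j) {m : ℕ+}
    (hm : m ∈ progression p i) : m ∉ progression p j := by
  intro h
  have h₁ := (mem_progression.1 hm).2.symm.trans (mem_progression.1 h).2
  rw [← PNat.coe_le_coe] at hi hj
  apply hij
  apply PNat.coe_injective
  have hi₀ := i.pos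
  have hj₀ := j.pos
  rcases le_total (i : ℕ) j with h | h
  · obtain ⟨k, hk⟩ := (Nat.modEq_iff_dvd' h).1 h₁
    rcases Nat.eq_zero_or_pos k with rfl | hk₀
    · omega
    · have := Nat.le_mul_of_pos_right (p : ℕ) hk₀
      omega
  · obtain ⟨k, hk⟩ := (Nat.modEq_iff_dvd' h).1 h₁.symm
    rcases Nat.eq_zero_or_pos k with rfl | hk₀
    · omega
    · have := Nat.le_mul_of_pos_right (p : ℕ) hk₀
      omega

theorem mem_FF_iff {p i : ℕ+} (hi : i ≤ p) {R : Rep.{u}} :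
    R ∈ FF p i ↔ ∃ Ω : R.H, R.IsCyclicVector Ω ∧ R.IsVacuum (progression p i) Ω := by
  refine exists_congr fun Ω => and_congr_right fun _ => ?_
  rw [Rep.isVacuum_iff]
  constructor
  · intro h
    refine ⟨?_, fun m hm => ?_⟩
    · rintro _ ⟨n, rfl⟩
      exact (h n).1
    · obtain ⟨n, j, hj, rfl⟩ := exists_modeIndex p m
      exact (h n).2 j hj fun hji => hm ⟨n, hji ▸ rfl⟩
  · intro h n
    exact ⟨h.1 _ ⟨n, rfl⟩, fun j hj hji => h.2 _ (progression_disjoint hj hi hji ⟨n, rfl⟩)⟩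

/-- For p = q the progressions are disjoint. For p < q, if m lies in both, then m + p lies only in
the first, because q does not divide p. -/
theorem progression_diff_infinite {p i q j : ℕ+} (hi : i ≤ p) (hj : j ≤ q)
    (hne : (p, i) ≠ (q, j)) (hpq : p ≤ q) :
    (progression p i \ progression q j).Infinite := by
  refine Set.infinite_of_forall_exists_gt fun N => ?_
  obtain ⟨m, hm, hNm⟩ : ∃ m ∈ progression p i, N < m := by
    refine ⟨_, ⟨N + 1, rfl⟩, ?_⟩
    rw [← PNat.coe_lt_coe, modeIndex_coe, PNat.add_coe, PNat.one_coe, Nat.add_sub_cancel]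
    have := Nat.le_mul_of_pos_left (N : ℕ) p.pos
    have := i.pos
    omega
  by_cases hmq : m ∈ progression q j
  · rcases hpq.eq_or_lt with rfl | hlt
    · exact absurd hmq (progression_disjoint hi hj (fun h => hne (h ▸ rfl)) hm)
    · have hmp : m + p ∈ progression p i := by
        rw [mem_progression] at hm ⊢
        refine ⟨hm.1.trans (PNat.lt_add_right m p).le, ?_⟩
        rw [PNat.add_coe, Nat.ModEq, Nat.add_mod_right]
        exact hm.2
      refine ⟨m + p, ⟨hmp, fun h => ?_⟩, hNm.trans (PNat.lt_add_right m p)⟩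
      have h₁ := (mem_progression.1 hmq).2.trans (mem_progression.1 h).2.symm
      have h₂ := (Nat.modEq_iff_dvd' (Nat.le_add_right (m : ℕ) p)).1 (by simpa using h₁)
      rw [Nat.add_sub_cancel_left] at h₂
      exact absurd (Nat.le_of_dvd p.pos h₂) (not_le.2 hlt)
  · exact ⟨m, ⟨hm, hmq⟩, hNm⟩

theorem symmDiff_progression_infinite {p i q j : ℕ+} (hi : i ≤ p) (hj : j ≤ q)
    (hne : (p, i) ≠ (q, j)) : (symmDiff (progression p i) (progression q j)).Infinite := by
  rcases le_total p q with h | h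
  · exact (progression_diff_infinite hi hj hne h).mono fun m hm => Or.inl hm
  · exact (progression_diff_infinite hj hi hne.symm h).mono fun m hm => Or.inr hm

/-! ### Weighted permutation operators on ℓ². -/

section WeightedPermutation

variable {ι : Type u}

/-- This one bound gives both square-summability of the image and operator norm at most 1. -/
theorem sum_weightedPerm_le {σ : ι → ι} (hσ : σ.Injective) {w : ι → ℂ} (hw : ∀ i, ‖w i‖ ≤ 1)
    (f : lp (fun _ : ι => ℂ) 2) (s : Finset ι) :
    ∑ i ∈ s, ‖w i * f (σ i)‖ ^ (2 : ℝ≥0∞).toReal ≤ ‖f‖ ^ (2 : ℝ≥0∞).toReal := by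
  classical
  calc ∑ i ∈ s, ‖w i * f (σ i)‖ ^ (2 : ℝ≥0∞).toReal
      ≤ ∑ i ∈ s, ‖f (σ i)‖ ^ (2 : ℝ≥0∞).toReal := by
        refine Finset.sum_le_sum fun i _ => Real.rpow_le_rpow (norm_nonneg _) ?_ (by simp)
        rw [norm_mul]
        exact mul_le_of_le_one_left (norm_nonneg _) (hw i)
    _ = ∑ i ∈ s.image σ, ‖f i‖ ^ (2 : ℝ≥0∞).toReal := by
        rw [Finset.sum_image hσ.injOn]
    _ ≤ ‖f‖ ^ (2 : ℝ≥0∞).toReal := lp.sum_rpow_le_norm_rpow (by simp) f _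

/-- The operator `f ↦ w · (f ∘ σ)` on `ℓ²`, for a contractive weight and an injective map. -/
def weightedPerm (σ : ι → ι) (hσ : σ.Injective) (w : ι → ℂ) (hw : ∀ i, ‖w i‖ ≤ 1) :
    lp (fun _ : ι => ℂ) 2 →L[ℂ] lp (fun _ : ι => ℂ) 2 :=
  LinearMap.mkContinuous
    { toFun f := ⟨fun i => w i * f (σ i), memℓp_gen' (sum_weightedPerm_le hσ hw f)⟩
      map_add' f g := by
        ext i
        exact mul_add _ _ _
      map_smul' c f := by
        ext i
        exact mul_left_comm _ _ _ }
    1 fun f => by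
      rw [one_mul]
      exact lp.norm_le_of_forall_sum_le (by simp) (norm_nonneg _) (sum_weightedPerm_le hσ hw f)

@[simp]
theorem weightedPerm_apply (σ : ι → ι) (hσ : σ.Injective) (w : ι → ℂ) (hw : ∀ i, ‖w i‖ ≤ 1)
    (f : lp (fun _ : ι => ℂ) 2) (i : ι) : weightedPerm σ hσ w hw f i = w i * f (σ i) := rfl

theorem star_weightedPerm {σ : ι → ι} (hσ : σ.Involutive) {w w' : ι → ℂ}
    (hw : ∀ i, ‖w i‖ ≤ 1) (hw' : ∀ i, ‖w' i‖ ≤ 1) (h : ∀ i, w' (σ i) = conj (w i)) :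
    star (weightedPerm σ hσ.injective w hw) = weightedPerm σ hσ.injective w' hw' := by
  rw [ContinuousLinearMap.star_eq_adjoint, eq_comm, ContinuousLinearMap.eq_adjoint_iff]
  intro f g
  rw [lp.inner_eq_tsum, lp.inner_eq_tsum, ← (hσ.toPerm σ).tsum_eq]
  refine tsum_congr fun i => ?_
  rw [Function.Involutive.coe_toPerm]
  simp only [weightedPerm_apply, RCLike.inner_apply, h, hσ i, map_mul, Complex.conj_conj]
  ring

end WeightedPermutation

/-! ### Configurations and Jordan–Wigner signs. -/

/-- Occupation configurations: finite sets of modes. -/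
abbrev Config : Type u := ULift.{u} (Finset ℕ+)

namespace Config

/-- Change the occupation of the mode `m`. -/
def toggle (m : ℕ+) (s : Config.{u}) : Config.{u} := ⟨symmDiff s.down {m}⟩

theorem toggle_involutive (m : ℕ+) : (toggle.{u} m).Involutive := fun _ =>
  ULift.ext _ _ (symmDiff_symmDiff_cancel_right _ _)

@[simp]
theorem toggle_toggle (m : ℕ+) (s : Config.{u}) : toggle m (toggle m s) = s :=
  toggle_involutive m s

theorem toggle_comm (m n : ℕ+) (s : Config.{u}) :
    toggle m (toggle n s) = toggle n (toggle m s) :=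
  ULift.ext _ _ (symmDiff_right_comm _ _ _)

theorem mem_toggle_self {m : ℕ+} {s : Config.{u}} : m ∈ (toggle m s).down ↔ m ∉ s.down := by
  simp [toggle, Finset.mem_symmDiff]

theorem mem_toggle_of_ne {m n : ℕ+} (h : m ≠ n) {s : Config.{u}} :
    m ∈ (toggle n s).down ↔ m ∈ s.down := by
  simp [toggle, Finset.mem_symmDiff, h]

/-- The parity of the number of occupied modes below `n`. -/
def sign (n : ℕ+) (s : Config.{u}) : ℂ := ∏ k ∈ s.down, if k < n then -1 else 1

theorem sign_toggle (n m : ℕ+) (s : Config.{u}) :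
    sign n (toggle m s) = (if m < n then -1 else 1) * sign n s := by
  have key : ∀ t : Config.{u}, m ∉ t.down →
      sign n (toggle m t) = (if m < n then -1 else 1) * sign n t := by
    intro t ht
    have : (toggle m t).down = insert m t.down := by
      ext k
      by_cases hk : k = m
      · subst hk; simp [mem_toggle_self, ht]
      · simp [mem_toggle_of_ne hk, hk]
    rw [sign, this, Finset.prod_insert ht, sign]
  by_cases hm : m ∈ s.down
  · have h := key (toggle m s) (fun h => mem_toggle_self.1 h hm)
    rw [toggle_toggle] at h
    rw [h, ← mul_assoc]
    split_ifs <;> simp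
  · exact key s hm

theorem sign_mul_self (n : ℕ+) (s : Config.{u}) : sign n s * sign n s = 1 := by
  rw [sign, ← Finset.prod_mul_distrib]
  refine Finset.prod_eq_one fun k _ => ?_
  split_ifs <;> simp

theorem sign_toggle_self (n : ℕ+) (s : Config.{u}) : sign n (toggle n s) = sign n s := by
  rw [sign_toggle, if_neg (lt_irrefl n), one_mul]

theorem norm_sign (n : ℕ+) (s : Config.{u}) : ‖sign n s‖ = 1 := by
  rw [sign, norm_prod]
  refine Finset.prod_eq_one fun k _ => ?_
  split_ifs <;> simp

theorem conj_sign (n : ℕ+) (s : Config.{u}) : conj (sign n s) = sign n s := by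
  rw [sign, map_prod]
  refine Finset.prod_congr rfl fun k _ => ?_
  split_ifs <;> simp

/-- Moving two different modes in opposite orders gives opposite signs. -/
theorem sign_mul_sign_toggle {n m : ℕ+} (h : n ≠ m) (s : Config.{u}) :
    sign n s * sign m (toggle n s) = -(sign m s * sign n (toggle m s)) := by
  rw [sign_toggle, sign_toggle]
  rcases lt_or_gt_of_ne h with h | h
  · rw [if_pos h, if_neg h.not_gt]; ring
  · rw [if_pos h, if_neg h.not_gt]; ring

end Config

open Config

/-! ### Creation and annihilation operators on Fock space. -/

/-- The fermionic Fock space. -/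
abbrev FockSpace : Type u := lp (fun _ : Config.{u} => ℂ) 2

/-- The Jordan–Wigner annihilation operator of the mode `m`. -/
def lower (m : ℕ+) : FockSpace.{u} →L[ℂ] FockSpace.{u} :=
  weightedPerm (toggle m) (toggle_involutive m).injective
    (fun s => if m ∈ s.down then 0 else sign m s)
    (fun s => by split_ifs <;> simp [norm_sign])

/-- The Jordan–Wigner creation operator of the mode `m`. -/
def raise (m : ℕ+) : FockSpace.{u} →L[ℂ] FockSpace.{u} :=
  weightedPerm (toggle m) (toggle_involutive m).injective
    (fun s => if m ∈ s.down then sign m s else 0)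
    (fun s => by split_ifs <;> simp [norm_sign])

theorem lower_apply (m : ℕ+) (f : FockSpace.{u}) (s : Config.{u}) :
    lower m f s = (if m ∈ s.down then 0 else sign m s) * f (toggle m s) := rfl

theorem raise_apply (m : ℕ+) (f : FockSpace.{u}) (s : Config.{u}) :
    raise m f s = (if m ∈ s.down then sign m s else 0) * f (toggle m s) := rfl

theorem star_lower (m : ℕ+) : star (lower.{u} m) = raise m := by
  refine star_weightedPerm (toggle_involutive m) _ _ fun s => ?_
  by_cases h : m ∈ s.down
  · simp [mem_toggle_self, h]
  · simp [mem_toggle_self, h, sign_toggle_self, conj_sign]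

theorem star_raise (m : ℕ+) : star (raise.{u} m) = lower m := by
  rw [← star_lower, star_star]

/-- For n = m one of the two weights vanishes; for n ≠ m both orders reach the same configuration
with opposite signs. -/
theorem lower_mul_lower (n m : ℕ+) : lower.{u} n * lower m + lower m * lower n = 0 := by
  ext f s
  change lower n (lower m f) s + lower m (lower n f) s = 0
  simp only [lower_apply]
  by_cases h : n = m
  · subst h
    by_cases hs : n ∈ s.down <;> simp [mem_toggle_self, hs]
  · rw [toggle_comm m n]
    simp only [mem_toggle_of_ne h, mem_toggle_of_ne (Ne.symm h)]
    by_cases hn : n ∈ s.down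
    · simp [hn]
    · by_cases hm : m ∈ s.down
      · simp [hm]
      · simp only [hn, hm, if_false]
        rw [← mul_assoc, ← mul_assoc, sign_mul_sign_toggle h]
        ring

theorem raise_mul_raise (n m : ℕ+) : raise.{u} n * raise m + raise m * raise n = 0 := by
  have := congrArg star (lower_mul_lower.{u} m n)
  simpa only [star_add, star_mul, star_lower, star_zero] using this

theorem lower_mul_raise (n m : ℕ+) :
    lower.{u} n * raise m + raise m * lower n = if n = m then 1 else 0 := by
  ext f s
  have h₁ : ((lower.{u} n * raise m + raise m * lower n) f) s
      = lower n (raise m f) s + raise m (lower n f) s := rfl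
  rw [h₁]
  simp only [lower_apply, raise_apply]
  by_cases h : n = m
  · subst h
    rw [if_pos rfl]
    change _ = f s
    simp only [mem_toggle_self, toggle_toggle, sign_toggle_self]
    by_cases hs : n ∈ s.down <;> simp [hs, ← mul_assoc, sign_mul_self]
  · rw [if_neg h, toggle_comm m n]
    change _ = (0 : ℂ)
    simp only [mem_toggle_of_ne h, mem_toggle_of_ne (Ne.symm h)]
    by_cases hn : n ∈ s.down
    · simp [hn]
    · by_cases hm : m ∈ s.down
      · simp only [hn, hm, if_false, if_true]
        rw [← mul_assoc, ← mul_assoc, sign_mul_sign_toggle h]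
        ring
      · simp [hm]

/-! ### The Fock representation with the modes outside A filled. -/

open Classical in
/-- The operators representing the letters when the modes outside `A` are filled. -/
def letterOp (A : Set ℕ+) : Letter → (FockSpace.{u} →L[ℂ] FockSpace.{u})
  | Sum.inl m => if m ∈ A then lower m else raise m
  | Sum.inr m => if m ∈ A then raise m else lower m

/-- The Fock representation as an algebra homomorphism. -/
def fockHom (A : Set ℕ+) : CARAlgebra →ₐ[ℂ] (FockSpace.{u} →L[ℂ] FockSpace.{u}) :=
  RingQuot.liftAlgHom ℂ ⟨FreeAlgebra.lift ℂ (letterOp A), by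
    intro x y h
    cases h with
    | annihilate_create n m =>
      have h₁ : FreeAlgebra.lift ℂ (letterOp.{u} A) (if n = m then 1 else 0)
          = if n = m then 1 else 0 := by
        split_ifs
        · exact map_one _
        · exact map_zero _
      rw [h₁]
      simp only [map_add, map_mul, FreeAlgebra.lift_ι_apply, letterOp]
      -- If only one mode is in `A`, a different Jordan–Wigner relation appears, with right side 0
      -- since the modes differ.
      by_cases hn : n ∈ A <;> by_cases hm : m ∈ A <;> simp only [hn, hm, if_true, if_false]
      · exact lower_mul_raise n m
      · rw [lower_mul_lower, if_neg (ne_of_mem_of_not_mem hn hm)]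
      · rw [raise_mul_raise, if_neg (ne_of_mem_of_not_mem hm hn).symm]
      · rw [add_comm, lower_mul_raise]
        simp only [eq_comm]
    | annihilate_annihilate n m =>
      simp only [map_add, map_mul, map_zero, FreeAlgebra.lift_ι_apply, letterOp]
      by_cases hn : n ∈ A <;> by_cases hm : m ∈ A <;> simp only [hn, hm, if_true, if_false]
      · exact lower_mul_lower n m
      · rw [lower_mul_raise, if_neg (ne_of_mem_of_not_mem hn hm)]
      · rw [add_comm, lower_mul_raise, if_neg (ne_of_mem_of_not_mem hm hn)]
      · exact raise_mul_raise n m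
    | create_create n m =>
      simp only [map_add, map_mul, map_zero, FreeAlgebra.lift_ι_apply, letterOp]
      by_cases hn : n ∈ A <;> by_cases hm : m ∈ A <;> simp only [hn, hm, if_true, if_false]
      · exact raise_mul_raise n m
      · rw [add_comm, lower_mul_raise, if_neg (ne_of_mem_of_not_mem hn hm).symm]
      · rw [lower_mul_raise, if_neg (ne_of_mem_of_not_mem hm hn).symm]
      · exact lower_mul_lower n m⟩

theorem fockHom_gen (A : Set ℕ+) (x : Letter) : fockHom.{u} A (gen x) = letterOp A x := by
  unfold fockHom gen
  exact (RingQuot.liftAlgHom_mkAlgHom_apply ℂ _ _ _).trans (FreeAlgebra.lift_ι_apply _ _)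

theorem star_letterOp (A : Set ℕ+) (x : Letter) :
    star (letterOp.{u} A x) = letterOp A x.swap := by
  rcases x with m | m <;> by_cases hm : m ∈ A <;>
    simp [letterOp, hm, star_lower, star_raise]

/-- The Fock representation in which the modes outside `A` are filled. -/
def fockRep (A : Set ℕ+) : Rep.{u} where
  H := FockSpace.{u}
  π :=
    { fockHom A with
      map_star' := fun x => by
        change fockHom A (star x) = star (fockHom A x)
        induction x using CARAlgebra.induction with
        | ha n => exact (by rw [a, star_gen, fockHom_gen, fockHom_gen, star_letterOp])
        | hs n => rw [a, star_gen, star_gen, fockHom_gen, fockHom_gen, star_letterOp]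
        | hc c =>
          rw [star_algebraMap', AlgHom.commutes, AlgHom.commutes]
          exact algebraMap_star_comm c
        | hadd x y hx hy => rw [star_add, map_add, map_add, star_add, hx, hy]
        | hmul x y hx hy => rw [star_mul, map_mul, map_mul, star_mul, hx, hy] }

/-- The exchanges in `annih` and `letterOp` cancel, so the empty configuration is the vacuum for
every `A`. -/
theorem fockHom_annih (A : Set ℕ+) (m : ℕ+) : fockHom.{u} A (annih A m) = lower m := by
  by_cases hm : m ∈ A
  · simp only [annih, hm, if_true, a, fockHom_gen, letterOp]
  · simp only [annih, hm, if_false, star_a, fockHom_gen, letterOp]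

theorem fockHom_star_annih (A : Set ℕ+) (m : ℕ+) :
    fockHom.{u} A (star (annih A m)) = raise m := by
  by_cases hm : m ∈ A
  · simp only [annih, hm, if_true, star_a, fockHom_gen, letterOp]
  · simp only [annih, hm, if_false, star_star, a, fockHom_gen, letterOp]

/-- The basis vector of a configuration. -/
def configVec (s : Finset ℕ+) : FockSpace.{u} := lp.single 2 ⟨s⟩ 1

theorem configVec_apply (s : Finset ℕ+) (t : Config.{u}) :
    configVec s t = if t.down = s then 1 else 0 := by
  rw [configVec, lp.single_apply, Pi.single_apply]
  exact if_congr (by rw [ULift.ext_iff]) rfl rfl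

theorem lower_configVec_empty (m : ℕ+) : lower m (configVec.{u} ∅) = 0 := by
  ext s
  change _ = (0 : ℂ)
  rw [lower_apply, configVec_apply]
  by_cases hs : m ∈ s.down
  · rw [if_pos hs, zero_mul]
  · have h : (toggle m s).down ≠ ∅ := Finset.ne_empty_of_mem (mem_toggle_self.2 hs)
    rw [if_neg h, mul_zero]

theorem raise_configVec {m : ℕ+} {s : Finset ℕ+} (hm : m ∉ s) :
    raise m (configVec.{u} s) = sign m (⟨s⟩ : Config.{u}) • configVec (insert m s) := by
  ext t
  change _ = sign m (⟨s⟩ : Config.{u}) * configVec (insert m s) t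
  have key : (toggle m t).down = s ↔ t.down = insert m s := by
    have h₁ : toggle m (⟨s⟩ : Config.{u}) = ⟨insert m s⟩ := by
      refine ULift.ext _ _ (Finset.ext fun k => ?_)
      by_cases hk : k = m
      · subst hk; simp [mem_toggle_self, hm]
      · simp [mem_toggle_of_ne hk, hk]
    rw [show (toggle m t).down = s ↔ toggle m t = ⟨s⟩ from ULift.ext_iff.symm,
      (toggle_involutive m).eq_iff, h₁, ULift.ext_iff]
  rw [raise_apply, configVec_apply, configVec_apply]
  simp only [key]
  by_cases ht : t.down = insert m s
  · have : toggle m t = ⟨s⟩ := ULift.ext _ _ (key.2 ht)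
    rw [if_pos (ht ▸ Finset.mem_insert_self m s), if_pos ht, ← sign_toggle_self, this]
  · rw [if_neg ht, mul_zero, mul_zero]

theorem exists_fockHom_eq_configVec (A : Set ℕ+) (s : Finset ℕ+) :
    ∃ x, fockHom A x (configVec ∅) = configVec.{u} s := by
  induction s using Finset.induction_on with
  | empty => exact ⟨1, by rw [map_one]; rfl⟩
  | insert m s hm ih =>
    obtain ⟨x, hx⟩ := ih
    -- The scalar cancels the sign produced by `raise_configVec`.
    refine ⟨sign m (⟨s⟩ : Config.{u}) • (star (annih A m) * x), ?_⟩
    rw [map_smul, map_mul, fockHom_star_annih]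
    change sign m (⟨s⟩ : Config.{u}) • raise m (fockHom A x (configVec ∅)) = _
    rw [hx, raise_configVec hm, smul_smul, sign_mul_self, one_smul]

theorem fockRep_isVacuum (A : Set ℕ+) : (fockRep.{u} A).IsVacuum A (configVec.{u} ∅) := by
  intro m
  change fockHom A (annih A m) (configVec ∅) = 0
  rw [fockHom_annih, lower_configVec_empty]

theorem fockRep_isCyclicVector (A : Set ℕ+) :
    (fockRep.{u} A).IsCyclicVector (configVec.{u} ∅) := by
  constructor
  · intro h
    have : configVec.{u} ∅ ⟨∅⟩ = 0 := congrArg (fun f : FockSpace.{u} => f ⟨∅⟩) h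
    simp [configVec_apply] at this
  · change Dense ((LinearMap.range ((fockRep.{u} A).orbit (configVec.{u} ∅)) :
      Submodule ℂ FockSpace.{u}) : Set FockSpace.{u})
    -- A vector orthogonal to the orbit is orthogonal to every `configVec`, so all its coordinates
    -- vanish.
    rw [Submodule.dense_iff_topologicalClosure_eq_top, Submodule.topologicalClosure_eq_top_iff,
      Submodule.eq_bot_iff]
    intro f hf
    ext ⟨s⟩
    obtain ⟨x, hx⟩ := exists_fockHom_eq_configVec.{u} A s
    have h : ⟪configVec.{u} s, f⟫_ℂ = 0 := hf _ ⟨x, hx⟩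
    rw [configVec, lp.inner_single_left] at h
    simpa using h

end Fermion
end

theorem mainTheorem7 :
    (∀ p i : ℕ+, i ≤ p →
      (Fermion.FF.{u} p i).Nonempty ∧
      ∀ R ∈ Fermion.FF.{u} p i, ∀ S ∈ Fermion.FF.{v} p i, R.UnitarilyEquivalent S) ∧
    (∀ p i q j : ℕ+, i ≤ p → j ≤ q → (p, i) ≠ (q, j) →
      ∀ R ∈ Fermion.FF.{u} p i, ∀ S ∈ Fermion.FF.{v} q j, ¬ R.UnitarilyEquivalent S) ∧
    (∀ p i : ℕ+, i ≤ p → ∀ R ∈ Fermion.FF.{u} p i, R.IsIrreducible) := by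
  refine ⟨fun p i hi => ⟨⟨Fermion.fockRep (Fermion.progression p i), ?_⟩, ?_⟩, ?_, ?_⟩
  · exact (Fermion.mem_FF_iff hi).2
      ⟨_, Fermion.fockRep_isCyclicVector _, Fermion.fockRep_isVacuum _⟩
  · intro R hR S hS
    obtain ⟨Ω, hΩ, h⟩ := (Fermion.mem_FF_iff hi).1 hR
    obtain ⟨Ω', hΩ', h'⟩ := (Fermion.mem_FF_iff hi).1 hS
    exact Fermion.Rep.unitarilyEquivalent_of_isVacuum hΩ hΩ' h h'
  · intro p i q j hi hj hne R hR S hS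
    obtain ⟨Ω, hΩ, h⟩ := (Fermion.mem_FF_iff hi).1 hR
    obtain ⟨Ω', hΩ', h'⟩ := (Fermion.mem_FF_iff hj).1 hS
    exact Fermion.Rep.not_unitarilyEquivalent_of_infinite hΩ hΩ' h h'
      (Fermion.symmDiff_progression_infinite hi hj hne)
  · intro p i hi R hR
    obtain ⟨Ω, hΩ, h⟩ := (Fermion.mem_FF_iff hi).1 hR
    exact Fermion.Rep.isIrreducible_of_isVacuum hΩ h
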